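/- A binary tree is a finite rooted tree in which every child is either a left or a right child and every node has at most one child of each kind; it is full if every node has outdegree $0$ or $2$. For a binary tree $T$, let $|T|_e$ be the number of its leaves, let $T^v$ be the fringe tree at the node $v$ (that is, $v$ with all its descendants), let $N_t(T)$ be the number of nodes $v$ of $T$ with $T^v=t$ (as binary trees), and let the compression $\widehat T$ be the full binary tree obtained from $T$ by deleting all nodes of outdegree $1$ and connecting the remaining nodes in the obvious way. Let $q(T;t\mid T)$ be the probability, given $T$, that a uniformly random leaf of $T$ lies in some fringe tree of $T$ equal to $t$, and for a random tree $T$ let $q(T;t)$ be the corresponding unconditional probability (first draw $T$, then a uniformly random leaf of $T$). Let $\mathcal B_n$ be the random binary search tree with $n$ nodes, built from $n$ distinct items: if $n=0$ the tree is empty; if $n\ge1$, choose one of the items uniformly at random as the pivot, and let the root have as its left and right subtrees the trees constructed recursively, and independently, from the items smaller and the items larger than the pivot. Let $\widehat{\mathcal B}_n$ be its compression, the compressed binary search tree. For a full binary tree $t$ put $$\hat\beta_t=\sum_{k=1}^\infty \frac{2}{(k+1)(k+2)}\,\mathbb P(\mathcal B_k\in\check t),$$ where $\check t$ is the set of binary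 trees that can be obtained from $t$ by subdividing edges (equivalently, the binary trees that compress to $t$ and whose root has outdegree $0$ or $2$). Then, for every full binary tree $t$, as $n\to\infty$, $\hat\beta_t$ is the limit in probability of the normalized fringe tree counts, $$\frac{N_t(\widehat{\mathcal B}_n)}{n}\xrightarrow{\ \mathrm p\ }\hat\beta_t,$$ and the extended fringe probabilities satisfy $$q(\widehat{\mathcal B}_n;t\mid\widehat{\mathcal B}_n)\xrightarrow{\ \mathrm p\ }3|t|_e\,\hat\beta_t\quad\text{(quenched)},\qquad q(\widehat{\mathcal B}_n;t)\longrightarrow 3|t|_e\,\hat\beta_t\quad\text{(annealed)}.$$ -/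

import Mathlib

open MeasureTheory ProbabilityTheory Filter Topology
open scoped ENNReal

/-- Shapes of finite binary trees (every child is a left or a right child). The value `nil` is the
empty tree (absence of a tree); the nonempty binary trees are the values other than `nil`. -/
abbrev BinTree : Type := BinaryTree Unit

/-- Trees form a countable discrete space. -/
instance instMeasurableSpaceBinTree : MeasurableSpace BinTree := ⊤

namespace BinTree

/-- The tree with left subtree `l` and right subtree `r` at the root. -/
abbrev mk (l r : BinTree) : BinTree := BinaryTree.node () l r

/-- The one-node tree. -/
abbrev single : BinTree := mk .nil .nil

/-- Full binary trees: nonempty binary trees in which every node has outdegree `0` or `2`. -/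
def IsFull : BinTree → Prop
  | .nil => False
  | .node _ l r => (l = .nil ∧ r = .nil) ∨ (IsFull l ∧ IsFull r)

/-- The nodes of a tree. A node is encoded by the path from the root to it: `false` is a step to
the left child and `true` a step to the right child. -/
def nodes : BinTree → Finset (List Bool)
  | .nil => ∅
  | .node _ l r => {[]} ∪ ((nodes l).image (List.cons false) ∪ (nodes r).image (List.cons true))

/-- The fringe tree `T^v`: the node `v` with all its descendants (`nil` if `v` is not a node). -/
def fringe : BinTree → List Bool → BinTree
  | T, [] => T
  | .nil, _ :: _ => .nil
  | .node _ l _, false :: v => fringe l v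
  | .node _ _ r, true :: v => fringe r v

/-- The leaves of a tree, i.e. the nodes without children. -/
def leaves (T : BinTree) : Finset (List Bool) :=
  (nodes T).filter fun v => fringe T v = single

/-- The leaf size of a tree, i.e. its number of leaves. -/
def leafSize (T : BinTree) : ℕ := (leaves T).card

/-- The number `N_t(T)` of fringe trees of `T` that are equal to `t`. -/
def fringeCount (t T : BinTree) : ℕ :=
  ((nodes T).filter fun v => fringe T v = t).card

/-- The compression of a tree: all nodes of outdegree `1` are deleted, the remaining nodes being
connected in the obvious way. -/
def compress : BinTree → BinTree
  | .nil => .nil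
  | .node _ l r =>
    if r = .nil then (if l = .nil then single else compress l)
    else if l = .nil then compress r
    else mk (compress l) (compress r)

/-- The number of children of the root. -/
def rootDegree : BinTree → ℕ
  | .nil => 0
  | .node _ l r => (if l = .nil then 0 else 1) + (if r = .nil then 0 else 1)

/-- The set of binary trees obtained from the full binary tree `t` by subdividing edges, that is,
by replacing every edge by a path with at least one edge. These are the trees that compress to `t`
and whose root has outdegree `0` or `2` (so that no path is added above the root). -/
def subdivisions (t : BinTree) : Set BinTree :=
  {T | compress T = t ∧ (rootDegree T = 0 ∨ rootDegree T = 2)}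

/-! ### Extended fringe probabilities -/

/-- The law of a uniformly random leaf of `T` (with a dummy value for the empty tree, which has
no leaves). -/
noncomputable def randomLeaf (T : BinTree) : PMF (List Bool) :=
  if h : (leaves T).Nonempty then PMF.uniformOfFinset (leaves T) h else PMF.pure []

/-- The node `v` of `T` lies in some fringe tree `T^w` that is equal to `t`. (The node `v` belongs
to `T^w` iff `w` is `v` or an ancestor of `v`, i.e. iff the path `w` is a prefix of `v`.) -/
def LiesInCopy (T : BinTree) (v : List Bool) (t : BinTree) : Prop :=
  ∃ w ∈ nodes T, w <+: v ∧ fringe T w = t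

/-- The quenched probability `q(T; t | T)`: the probability, for the given tree `T`, that a
uniformly random leaf of `T` lies in some fringe tree of `T` that is equal to `t`. -/
noncomputable def quenchedQ (T t : BinTree) : ℝ :=
  ((randomLeaf T).toOuterMeasure {v | LiesInCopy T v t}).toReal

/-- The annealed probability `q(T; t)` for a random tree `T` with law `p`: first `T` is drawn
from `p`, then a uniformly random leaf `v` of `T` is drawn, and `q(T; t)` is the probability that
`v` lies in some fringe tree of `T` that is equal to `t`. -/
noncomputable def annealedQ (p : PMF BinTree) (t : BinTree) : ℝ :=
  ((p.bind fun T => (randomLeaf T).map fun v => (T, v)).toOuterMeasure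
    {x | LiesInCopy x.1 x.2 t}).toReal

/-! ### Random binary search trees -/

/-- The law of the binary search tree built from a finite set `s` of distinct items: if `s` is
empty the tree is empty; otherwise a uniformly random pivot `p ∈ s` is chosen, and the left and
right subtrees of the root are built in the same way, independently, from the items smaller than
`p` and from the items larger than `p`. -/
noncomputable def bstOf {α : Type*} [LinearOrder α] (s : Finset α) : PMF BinTree :=
  if h : s.Nonempty then
    haveI : Nonempty s := h.to_subtype
    (PMF.uniformOfFintype s).bind fun p =>
      (bstOf (s.filter (· < p.1))).bind fun l =>
        (bstOf (s.filter (p.1 < ·))).bind fun r =>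
          PMF.pure (mk l r)
  else PMF.pure .nil
termination_by s.card
decreasing_by
  · exact Finset.card_lt_card (Finset.filter_ssubset.2 ⟨p.1, p.2, lt_irrefl _⟩)
  · exact Finset.card_lt_card (Finset.filter_ssubset.2 ⟨p.1, p.2, lt_irrefl _⟩)

/-- The law of the random binary search tree with `n` nodes. -/
noncomputable def bst (n : ℕ) : PMF BinTree := bstOf (Finset.range n)

/-- The law of the compressed random binary search tree. -/
noncomputable def compressedBst (n : ℕ) : PMF BinTree := (bst n).map compress

/-- The constant `∑_{k ≥ 1} 2 / ((k + 1) (k + 2)) * P(the BST with k nodes is a subdivision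
of t)`. -/
noncomputable def betaHat (t : BinTree) : ℝ :=
  ∑' j : ℕ, 2 / (((j + 1 : ℕ) + 1 : ℝ) * ((j + 1 : ℕ) + 2 : ℝ)) *
    ((bst (j + 1)).toOuterMeasure (subdivisions t)).toReal

end BinTree

/-! A node of outdegree other than 1 survives compression, and the fringe tree there becomes its
compression. Hence `N_t` of the compressed tree counts the fringe trees of the original tree that
lie in `subdivisions t` (`fringeCount_compress`): an additive functional whose toll is an indicator.

For any set `S` of trees, the pivot recursion gives the mean of this count an explicitly solvable
recurrence (`recurrence_solution`); the mean is `density S * (n + 1) + O(1)`. Centring by `density S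
* (numNodes + 1)` keeps the functional additive with the same toll and makes its mean bounded. In
the second moment the cross term is a product of bounded means, since the subtrees are independent
given their sizes, so the same recurrence holds with a toll `O(n)` and gives `O(n log n)`.
Chebyshev's inequality then gives the law of large numbers (`tendstoInProb_additive`).

Copies of `t` in a tree are disjoint, so the quenched probability is `|t|_e` times the count of `t`
divided by the number of leaves. Leaves are the case `t = single`, with density 1/3, whence the
factor 3. The annealed limit follows by bounded convergence, as probabilities lie in [0, 1]. -/

namespace BinTree

/-! ### Expectations through the pivot recursion -/

/-- The expectation of `φ` at the random binary search tree with `n` nodes, computed by the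
recursion for the root pivot. -/
noncomputable def expect : ℕ → (BinTree → ℝ) → ℝ
  | 0, φ => φ .nil
  | n + 1, φ =>
    (∑ j : Fin (n + 1), expect j (fun l => expect (n - j) (fun r => φ (mk l r)))) / (n + 1)

theorem expect_zero (φ : BinTree → ℝ) : expect 0 φ = φ .nil := by rw [expect]

theorem expect_succ (n : ℕ) (φ : BinTree → ℝ) :
    expect (n + 1) φ =
      (∑ j ∈ Finset.range (n + 1),
        expect j (fun l => expect (n - j) (fun r => φ (mk l r)))) / (n + 1) := by
  rw [expect, Finset.sum_range]

/-- The recursion evaluates `φ` only at trees with exactly `n` nodes, so a comparison there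
suffices. Deterministic bounds in terms of size enter the moment estimates this way. -/
theorem expect_mono {n : ℕ} {φ ψ : BinTree → ℝ}
    (h : ∀ T : BinTree, T.numNodes = n → φ T ≤ ψ T) : expect n φ ≤ expect n ψ := by
  induction n using Nat.strong_induction_on generalizing φ ψ with
  | _ n ih =>
    cases n with
    | zero => simpa only [expect_zero] using h .nil rfl
    | succ n =>
      simp only [expect_succ]
      refine div_le_div_of_nonneg_right (Finset.sum_le_sum fun j hj => ?_) (by positivity)
      have hj' := Finset.mem_range.1 hj
      refine ih j hj' fun l hl => ih (n - j) (by omega) fun r hr => h _ ?_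
      simp only [BinaryTree.numNodes]
      omega

theorem expect_congr {n : ℕ} {φ ψ : BinTree → ℝ}
    (h : ∀ T : BinTree, T.numNodes = n → φ T = ψ T) : expect n φ = expect n ψ :=
  le_antisymm (expect_mono fun T hT => (h T hT).le) (expect_mono fun T hT => (h T hT).ge)

theorem expect_add (n : ℕ) (φ ψ : BinTree → ℝ) :
    expect n (fun T => φ T + ψ T) = expect n φ + expect n ψ := by
  induction n using Nat.strong_induction_on generalizing φ ψ with
  | _ n ih =>
    cases n with
    | zero => simp only [expect_zero]
    | succ n =>
      simp only [expect_succ]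
      rw [← add_div, ← Finset.sum_add_distrib]
      congr 1
      refine Finset.sum_congr rfl fun j hj => ?_
      have hj' := Finset.mem_range.1 hj
      simp only [ih (n - j) (by omega)]
      rw [ih j hj']

theorem expect_mul_left (n : ℕ) (c : ℝ) (φ : BinTree → ℝ) :
    expect n (fun T => c * φ T) = c * expect n φ := by
  induction n using Nat.strong_induction_on generalizing φ with
  | _ n ih =>
    cases n with
    | zero => simp only [expect_zero]
    | succ n =>
      simp only [expect_succ]
      rw [← mul_div_assoc, Finset.mul_sum]
      congr 1
      refine Finset.sum_congr rfl fun j hj => ?_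
      have hj' := Finset.mem_range.1 hj
      simp only [ih (n - j) (by omega)]
      rw [ih j hj']

theorem expect_const (n : ℕ) (c : ℝ) : expect n (fun _ => c) = c := by
  induction n using Nat.strong_induction_on with
  | _ n ih =>
    cases n with
    | zero => simp only [expect_zero]
    | succ n =>
      rw [expect_succ, Finset.sum_congr rfl (g := fun _ => c)]
      · simp only [Finset.sum_const, Finset.card_range, nsmul_eq_mul]
        push_cast
        field_simp
      · intro j hj
        have hj' := Finset.mem_range.1 hj
        simp only [ih (n - j) (by omega), ih j hj']

theorem expect_nonneg {n : ℕ} {φ : BinTree → ℝ} (h : ∀ T, 0 ≤ φ T) : 0 ≤ expect n φ := by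
  simpa only [expect_const] using expect_mono (n := n) (φ := fun _ => 0) fun T _ => h T

/-- The probability that the random binary search tree with `n` nodes lies in `S`. -/
noncomputable def prob (n : ℕ) (S : Set BinTree) : ℝ := expect n (S.indicator 1)

theorem prob_nonneg (n : ℕ) (S : Set BinTree) : 0 ≤ prob n S :=
  expect_nonneg fun T => Set.indicator_nonneg (fun _ _ => zero_le_one) T

theorem prob_le_one (n : ℕ) (S : Set BinTree) : prob n S ≤ 1 := by
  rw [← expect_const n 1]
  exact expect_mono fun T _ => Set.indicator_le_self' (fun _ _ => zero_le_one) T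

theorem prob_le_add {n : ℕ} {S A B : Set BinTree} (h : S ⊆ A ∪ B) :
    prob n S ≤ prob n A + prob n B := by
  classical
  rw [prob, prob, prob, ← expect_add]
  refine expect_mono fun T _ => ?_
  by_cases hS : T ∈ S
  · rcases h hS with hA | hB
    · simp only [Set.indicator_of_mem hS, Set.indicator_of_mem hA, le_add_iff_nonneg_right]
      exact Set.indicator_nonneg (fun _ _ => zero_le_one) T
    · simp only [Set.indicator_of_mem hS, Set.indicator_of_mem hB, le_add_iff_nonneg_left]
      exact Set.indicator_nonneg (fun _ _ => zero_le_one) T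
  · rw [Set.indicator_of_notMem hS]
    exact add_nonneg (Set.indicator_nonneg (fun _ _ => zero_le_one) T)
      (Set.indicator_nonneg (fun _ _ => zero_le_one) T)

/-! ### The law of the random binary search tree -/

theorem tsum_bind_mul {α β : Type*} (p : PMF α) (f : α → PMF β) (φ : β → ℝ≥0∞) :
    ∑' b, p.bind f b * φ b = ∑' a, p a * ∑' b, f a b * φ b := by
  simp only [PMF.bind_apply, ← ENNReal.tsum_mul_right, ← ENNReal.tsum_mul_left, mul_assoc]
  exact ENNReal.tsum_comm

theorem tsum_pure_mul {α : Type*} (a : α) (φ : α → ℝ≥0∞) :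
    ∑' b, PMF.pure a b * φ b = φ a := by
  rw [tsum_eq_single a fun b hb => by rw [PMF.pure_apply_of_ne _ _ hb, zero_mul]]
  rw [PMF.pure_apply_self, one_mul]

theorem card_filter_lt_add_card_filter_gt {α : Type*} [LinearOrder α] {s : Finset α} {p : α}
    (hp : p ∈ s) : (s.filter (· < p)).card + (s.filter (p < ·)).card + 1 = s.card := by
  have h1 : (s.filter (p < ·)).card + 1 = (s.filter (¬ · < p)).card := by
    rw [← Finset.card_insert_of_notMem (s := s.filter (p < ·)) (a := p) (by simp)]
    congr 1
    ext x
    simp only [Finset.mem_insert, Finset.mem_filter, not_lt, le_iff_eq_or_lt]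
    constructor
    · rintro (rfl | ⟨h, h'⟩)
      · exact ⟨hp, Or.inl rfl⟩
      · exact ⟨h, Or.inr h'⟩
    · rintro ⟨h, rfl | h'⟩
      · exact Or.inl rfl
      · exact Or.inr ⟨h, h'⟩
  rw [add_assoc, h1, Finset.card_filter_add_card_filter_not]

/-- The rank of the pivot, `p ↦ #{x ∈ s | x < p}`, is a bijection from `s` onto `range s.card`; a
uniform pivot therefore has a uniform rank. -/
theorem sum_card_filter_lt {α M : Type*} [LinearOrder α] [AddCommMonoid M] (s : Finset α)
    (g : ℕ → M) :
    ∑ p ∈ s, g (s.filter (· < p)).card = ∑ j ∈ Finset.range s.card, g j := by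
  have hinj : Set.InjOn (fun p => (s.filter (· < p)).card) s := by
    have key : ∀ p ∈ s, ∀ q, p < q → (s.filter (· < p)).card < (s.filter (· < q)).card := by
      intro p hp q hpq
      refine Finset.card_lt_card ⟨fun x hx => ?_, fun h => ?_⟩
      · simp only [Finset.mem_filter] at hx ⊢
        exact ⟨hx.1, hx.2.trans hpq⟩
      · exact lt_irrefl p (Finset.mem_filter.1 (h (Finset.mem_filter.2 ⟨hp, hpq⟩))).2
    intro p hp q hq h
    rcases lt_trichotomy p q with h' | h' | h'
    · exact absurd h (key p hp q h').ne
    · exact h'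
    · exact absurd h (key q hq p h').ne'
  have himg : s.image (fun p => (s.filter (· < p)).card) = Finset.range s.card := by
    refine Finset.eq_of_subset_of_card_le (fun j hj => ?_) ?_
    · obtain ⟨p, hp, rfl⟩ := Finset.mem_image.1 hj
      have := card_filter_lt_add_card_filter_gt hp
      exact Finset.mem_range.2 (by omega)
    · rw [Finset.card_range, Finset.card_image_of_injOn hinj]
  rw [← himg, Finset.sum_image hinj]

/-- The shape depends on the items only through the ranks of the pivots, so the law sees only
`s.card`. Working in `ℝ≥0∞` avoids summability conditions. -/
theorem tsum_bstOf_mul {α : Type*} [LinearOrder α] (s : Finset α) {ψ : BinTree → ℝ}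
    (hψ : ∀ T, 0 ≤ ψ T) :
    ∑' T, bstOf s T * ENNReal.ofReal (ψ T) = ENNReal.ofReal (expect s.card ψ) := by
  induction hn : s.card using Nat.strong_induction_on generalizing s ψ with
  | _ n ih =>
    subst hn
    rw [bstOf]
    split_ifs with h
    · have : Nonempty s := h.to_subtype
      rw [tsum_bind_mul]
      simp only [tsum_bind_mul, tsum_pure_mul]
      have hsub : ∀ p : s,
          ∑' l, bstOf (s.filter (· < p.1)) l * ∑' r, bstOf (s.filter (p.1 < ·)) r *
            ENNReal.ofReal (ψ (mk l r)) =
          ENNReal.ofReal (expect (s.filter (· < p.1)).card (fun l =>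
            expect (s.card - 1 - (s.filter (· < p.1)).card) (fun r => ψ (mk l r)))) := by
        intro p
        have hc := card_filter_lt_add_card_filter_gt p.2
        have hc' : s.card - 1 - (s.filter (· < p.1)).card = (s.filter (p.1 < ·)).card := by
          omega
        rw [hc']
        simp only [ih _ (by omega) (s.filter (p.1 < ·)) (fun r => hψ (mk _ r)) rfl]
        exact ih _ (by omega) _ (fun l => expect_nonneg fun r => hψ _) rfl
      simp only [hsub, PMF.uniformOfFintype_apply, tsum_fintype, Fintype.card_coe]
      rw [← Finset.mul_sum, Finset.sum_coe_sort s (fun p => ENNReal.ofReal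
        (expect (s.filter (· < p)).card (fun l =>
          expect (s.card - 1 - (s.filter (· < p)).card) (fun r => ψ (mk l r))))),
        sum_card_filter_lt s (fun j => ENNReal.ofReal
        (expect j (fun l => expect (s.card - 1 - j) (fun r => ψ (mk l r)))))]
      obtain ⟨n, hn⟩ : ∃ n, s.card = n + 1 := ⟨s.card - 1, by have := h.card_pos; omega⟩
      rw [hn, expect_succ, ENNReal.ofReal_div_of_pos (by positivity),
        ENNReal.ofReal_sum_of_nonneg fun j _ => expect_nonneg fun l => expect_nonneg fun r => hψ _,
        mul_comm, ← div_eq_mul_inv, Nat.add_sub_cancel]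
      congr 1
      rw [← Nat.cast_succ, ENNReal.ofReal_natCast]
    · rw [Finset.not_nonempty_iff_eq_empty.1 h, Finset.card_empty, expect_zero, tsum_pure_mul]

theorem tsum_bst_mul (n : ℕ) {ψ : BinTree → ℝ} (hψ : ∀ T, 0 ≤ ψ T) :
    ∑' T, bst n T * ENNReal.ofReal (ψ T) = ENNReal.ofReal (expect n ψ) := by
  rw [bst, tsum_bstOf_mul _ hψ, Finset.card_range]

theorem toOuterMeasure_bst (n : ℕ) (S : Set BinTree) :
    (bst n).toOuterMeasure S = ENNReal.ofReal (prob n S) := by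
  classical
  rw [prob, ← tsum_bst_mul n (ψ := S.indicator 1) fun T => Set.indicator_nonneg (fun _ _ => zero_le_one) T,
    PMF.toOuterMeasure_apply]
  refine tsum_congr fun T => ?_
  by_cases h : T ∈ S <;> simp [h]

theorem toReal_toOuterMeasure_bst (n : ℕ) (S : Set BinTree) :
    ((bst n).toOuterMeasure S).toReal = prob n S := by
  rw [toOuterMeasure_bst, ENNReal.toReal_ofReal (prob_nonneg n S)]

theorem betaHat_eq (t : BinTree) :
    betaHat t = ∑' j : ℕ, 2 / (((j : ℝ) + 2) * (j + 3)) * prob (j + 1) (subdivisions t) := by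
  refine tsum_congr fun j => ?_
  rw [toReal_toOuterMeasure_bst]
  push_cast
  ring_nf

/-- Convergence in probability of functionals of random binary search trees. -/
def TendstoInProb (φ : ℕ → BinTree → ℝ) (c : ℝ) : Prop :=
  ∀ ε > 0, Tendsto (fun n => prob n {T | ε ≤ |φ n T - c|}) atTop (𝓝 0)

/-- Convergence in probability to a constant involves only the law of each `T n`, so the coupling
between different `n` is immaterial. -/
theorem TendstoInProb.tendstoInMeasure {Ω : Type*} [MeasurableSpace Ω] {P : Measure Ω}
    {T : ℕ → Ω → BinTree} (hT : ∀ n, HasLaw (T n) (bst n).toMeasure P)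
    {φ : ℕ → BinTree → ℝ} {c : ℝ} (h : TendstoInProb φ c) :
    TendstoInMeasure P (fun n ω => φ n (T n ω)) atTop (fun _ => c) := by
  rw [tendstoInMeasure_iff_dist]
  intro ε hε
  have key : ∀ n, P {ω | ε ≤ dist (φ n (T n ω)) c} =
      ENNReal.ofReal (prob n {T | ε ≤ |φ n T - c|}) := by
    intro n
    rw [← toOuterMeasure_bst,
      ← PMF.toMeasure_apply_eq_toOuterMeasure_apply _ MeasurableSpace.measurableSet_top,
      ← (hT n).map_eq, Measure.map_apply_of_aemeasurable (hT n).aemeasurable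
        MeasurableSpace.measurableSet_top]
    rfl
  simp only [key]
  simpa using ENNReal.tendsto_ofReal (h ε hε)

/-! ### Fringe trees and compression -/

theorem card_filter_nodes_node (u : Unit) (l r : BinTree) (p : List Bool → Prop)
    [DecidablePred p] :
    ((nodes (.node u l r)).filter p).card =
      (if p [] then 1 else 0) + ((nodes l).filter fun v => p (false :: v)).card +
        ((nodes r).filter fun v => p (true :: v)).card := by
  have h1 : Disjoint ((nodes l).image (List.cons false)) ((nodes r).image (List.cons true)) := by
    rw [Finset.disjoint_left]
    intro x hx hx'
    obtain ⟨a, -, rfl⟩ := Finset.mem_image.1 hx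
    obtain ⟨b, -, hb⟩ := Finset.mem_image.1 hx'
    simp at hb
  have h2 : Disjoint ({[]} : Finset (List Bool))
      ((nodes l).image (List.cons false) ∪ (nodes r).image (List.cons true)) := by
    simp
  rw [nodes, Finset.filter_union,
    Finset.card_union_of_disjoint (Finset.disjoint_filter_filter h2), Finset.filter_union,
    Finset.card_union_of_disjoint (Finset.disjoint_filter_filter h1), Finset.filter_image,
    Finset.filter_image, Finset.card_image_of_injective _ List.cons_injective,
    Finset.card_image_of_injective _ List.cons_injective, Finset.filter_singleton, add_assoc]
  congr 1
  split_ifs <;> rfl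

theorem fringeCount_nil (t : BinTree) : fringeCount t .nil = 0 := rfl

theorem fringeCount_mk (t l r : BinTree) :
    fringeCount t (mk l r) =
      (if mk l r = t then 1 else 0) + fringeCount t l + fringeCount t r := by
  unfold fringeCount
  rw [card_filter_nodes_node]
  rfl

theorem leafSize_eq_fringeCount (T : BinTree) : leafSize T = fringeCount single T := rfl

theorem fringeCount_eq_zero {t T : BinTree} (h : T.numNodes < t.numNodes) :
    fringeCount t T = 0 := by
  induction T with
  | nil => rfl
  | node u l r ihl ihr =>
    simp only [BinaryTree.numNodes] at h
    rw [fringeCount_mk, ihl (by omega), ihr (by omega), if_neg]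
    rintro rfl
    simp [BinaryTree.numNodes] at h

theorem fringeCount_self (l r : BinTree) : fringeCount (mk l r) (mk l r) = 1 := by
  rw [fringeCount_mk, if_pos rfl, fringeCount_eq_zero, fringeCount_eq_zero] <;>
    simp only [BinaryTree.numNodes] <;> omega

/-- The sum of the toll `f` over all fringe trees of a binary tree. -/
noncomputable def additive (f : BinTree → ℝ) : BinTree → ℝ
  | .nil => 0
  | .node _ l r => f (mk l r) + additive f l + additive f r

theorem compress_eq_nil {T : BinTree} : compress T = .nil ↔ T = .nil := by
  induction T with
  | nil => simp [compress]
  | node u l r ihl ihr =>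
    rw [compress]
    split_ifs with hr hl hl
    · simp
    · simp [ihl, hl]
    · simp [ihr, hr]
    · simp

theorem mk_mem_subdivisions {t l r : BinTree} :
    mk l r ∈ subdivisions t ↔
      compress (mk l r) = t ∧ (l = .nil ∧ r = .nil ∨ l ≠ .nil ∧ r ≠ .nil) := by
  by_cases hl : l = .nil <;> by_cases hr : r = .nil <;> simp [subdivisions, rootDegree, hl, hr]

/-- At a root of outdegree 1 the compression adds no node and the indicator vanishes; at any other
root both sides gain 1 exactly when the whole tree compresses to `t`. -/
theorem fringeCount_compress (t T : BinTree) :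
    (fringeCount t (compress T) : ℝ) = additive ((subdivisions t).indicator 1) T := by
  classical
  induction T with
  | nil => simp [compress, additive, fringeCount_nil]
  | node u l r ihl ihr =>
    rw [additive, ← ihl, ← ihr, Set.indicator_apply]
    simp only [mk_mem_subdivisions, compress]
    by_cases hl : l = .nil <;> by_cases hr : r = .nil <;>
      simp [hl, hr, fringeCount_mk, fringeCount_nil, compress]

theorem subdivisions_single : subdivisions single = {single} := by
  ext T
  simp only [subdivisions, Set.mem_ofPred_eq, Set.mem_singleton_iff]
  constructor
  · rintro ⟨hc, hd⟩
    cases T with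
    | nil => simp [compress] at hc
    | node u l r =>
      rw [compress] at hc
      simp only [rootDegree] at hd
      split_ifs at hc hd with hr hl hl <;> simp_all [compress_eq_nil]
  · rintro rfl
    simp [compress, rootDegree]

/-! ### The quenched extended fringe probability -/

theorem liesInCopy_cons_false {l r t : BinTree} (h : mk l r ≠ t) (v : List Bool) :
    LiesInCopy (mk l r) (false :: v) t ↔ LiesInCopy l v t := by
  simp only [LiesInCopy, nodes, Finset.mem_union, Finset.mem_singleton, Finset.mem_image]
  constructor
  · rintro ⟨w, rfl | ⟨w, hw, rfl⟩ | ⟨w, hw, rfl⟩, hwv, hf⟩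
    · exact absurd hf h
    · exact ⟨w, hw, (List.cons_prefix_cons.1 hwv).2, hf⟩
    · simp at hwv
  · rintro ⟨w, hw, hwv, hf⟩
    exact ⟨false :: w, Or.inr (Or.inl ⟨w, hw, rfl⟩), List.cons_prefix_cons.2 ⟨rfl, hwv⟩, hf⟩

theorem liesInCopy_cons_true {l r t : BinTree} (h : mk l r ≠ t) (v : List Bool) :
    LiesInCopy (mk l r) (true :: v) t ↔ LiesInCopy r v t := by
  simp only [LiesInCopy, nodes, Finset.mem_union, Finset.mem_singleton, Finset.mem_image]
  constructor
  · rintro ⟨w, rfl | ⟨w, hw, rfl⟩ | ⟨w, hw, rfl⟩, hwv, hf⟩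
    · exact absurd hf h
    · simp at hwv
    · exact ⟨w, hw, (List.cons_prefix_cons.1 hwv).2, hf⟩
  · rintro ⟨w, hw, hwv, hf⟩
    exact ⟨true :: w, Or.inr (Or.inr ⟨w, hw, rfl⟩), List.cons_prefix_cons.2 ⟨rfl, hwv⟩, hf⟩

theorem not_liesInCopy_nil {l r t : BinTree} (h : mk l r ≠ t) :
    ¬ LiesInCopy (mk l r) [] t := by
  rintro ⟨w, -, hw, hf⟩
  rw [List.prefix_nil] at hw
  subst hw
  exact h hf

open Classical in
-- If `T = t`, the root is the only copy, by size, and contains every leaf. Otherwise each copy lies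
-- inside one of the two subtrees and the counts add.
theorem card_filter_liesInCopy (t T : BinTree) :
    ((leaves T).filter fun v => LiesInCopy T v t).card = leafSize t * fringeCount t T := by
  induction T with
  | nil => simp [leaves, nodes, fringeCount_nil]
  | node u l r ihl ihr =>
    by_cases h : mk l r = t
    · subst h
      rw [fringeCount_self, mul_one, leafSize, Finset.filter_true_of_mem]
      intro v _
      exact ⟨[], by simp [nodes], List.nil_prefix, rfl⟩
    · simp only [leaves, Finset.filter_filter] at ihl ihr ⊢
      rw [card_filter_nodes_node, fringeCount_mk, if_neg h,
        if_neg fun h' => not_liesInCopy_nil h h'.2]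
      simp only [liesInCopy_cons_false h, liesInCopy_cons_true h]
      rw [zero_add, zero_add, mul_add, ← ihl, ← ihr]
      congr

theorem leafSize_pos (l r : BinTree) : 0 < leafSize (mk l r) := by
  suffices h : ∀ T : BinTree, T ≠ .nil → 0 < leafSize T from h _ (by simp)
  intro T
  induction T with
  | nil => simp
  | node u l r ihl ihr =>
    intro _
    simp only [leafSize_eq_fringeCount] at ihl ihr ⊢
    rw [fringeCount_mk]
    by_cases hl : l = .nil
    · by_cases hr : r = .nil
      · simp [hl, hr]
      · exact Nat.add_pos_right _ (ihr hr)
    · exact Nat.add_pos_left (Nat.add_pos_right _ (ihl hl)) _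

theorem quenchedQ_eq (T t : BinTree) :
    quenchedQ T t = leafSize t * fringeCount t T / leafSize T := by
  classical
  cases T with
  -- The dummy leaf `[]` lies in no copy because the empty tree has no nodes; the right side is 0 by
  -- division by zero.
  | nil => simp [quenchedQ, randomLeaf, leaves, nodes, fringeCount_nil, LiesInCopy]
  | node u l r =>
    have h : (leaves (mk l r)).Nonempty := Finset.card_pos.1 (leafSize_pos l r)
    rw [quenchedQ, randomLeaf, dif_pos h, PMF.toOuterMeasure_uniformOfFinset_apply,
      ENNReal.toReal_div, ENNReal.toReal_natCast, ENNReal.toReal_natCast, ← Nat.cast_mul,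
      ← card_filter_liesInCopy]
    rfl

theorem quenchedQ_nonneg (T t : BinTree) : 0 ≤ quenchedQ T t := ENNReal.toReal_nonneg

theorem toOuterMeasure_le_one {α : Type*} (p : PMF α) (s : Set α) : p.toOuterMeasure s ≤ 1 := by
  rw [← (p.toOuterMeasure_apply_eq_one_iff (s := Set.univ)).2 (Set.subset_univ _)]
  exact measure_mono (Set.subset_univ s)

theorem quenchedQ_le_one (T t : BinTree) : quenchedQ T t ≤ 1 :=
  ENNReal.toReal_le_of_le_ofReal zero_le_one (by
    rw [ENNReal.ofReal_one]
    exact toOuterMeasure_le_one _ _)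

theorem annealedQ_compressedBst (n : ℕ) (t : BinTree) :
    annealedQ (compressedBst n) t = expect n fun T => quenchedQ T.compress t := by
  rw [← ENNReal.toReal_ofReal (expect_nonneg fun T => quenchedQ_nonneg _ t),
    ← tsum_bst_mul n fun T => quenchedQ_nonneg _ t, annealedQ, compressedBst, PMF.bind_map,
    PMF.toOuterMeasure_bind_apply]
  congr 1
  refine tsum_congr fun T => ?_
  rw [Function.comp_apply, PMF.toOuterMeasure_map_apply, quenchedQ, ENNReal.ofReal_toReal]
  · rfl
  · exact ((toOuterMeasure_le_one _ _).trans_lt ENNReal.one_lt_top).ne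

/-! ### The first two moments of additive functionals -/

/-- The partial sums satisfy `S (n + 1) = g n + (n + 3) / (n + 1) * S n`; dividing by `(n + 2) * (n
+ 3) / 2` makes this telescope. -/
theorem recurrence_sum {x g : ℕ → ℝ}
    (h : ∀ n : ℕ, x (n + 1) = g n + 2 / (n + 1) * ∑ j ∈ Finset.range (n + 1), x j) (n : ℕ) :
    ∑ j ∈ Finset.range (n + 1), x j = ((n : ℝ) + 1) * (n + 2) / 2 *
      (x 0 + ∑ k ∈ Finset.range n, 2 / (((k : ℝ) + 2) * (k + 3)) * g k) := by
  induction n with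
  | zero => simp
  | succ n ih =>
    rw [Finset.sum_range_succ, h, ih, Finset.sum_range_succ _ n]
    push_cast
    field_simp
    ring

theorem recurrence_solution {x g : ℕ → ℝ}
    (h : ∀ n : ℕ, x (n + 1) = g n + 2 / (n + 1) * ∑ j ∈ Finset.range (n + 1), x j) (n : ℕ) :
    x (n + 1) = g n +
      (n + 2) * (x 0 + ∑ k ∈ Finset.range n, 2 / (((k : ℝ) + 2) * (k + 3)) * g k) := by
  rw [h, recurrence_sum h]
  field_simp

theorem expect_left_add_right (n : ℕ) (χ : BinTree → ℝ) :
    expect (n + 1) (fun T => χ T.left + χ T.right) =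
      2 / (n + 1) * ∑ j ∈ Finset.range (n + 1), expect j χ := by
  rw [expect_succ]
  simp only [BinaryTree.left, BinaryTree.right, expect_add, expect_const]
  rw [Finset.sum_add_distrib]
  have := Finset.sum_range_reflect (fun j => expect j χ) (n + 1)
  simp only [Nat.add_sub_cancel] at this
  rw [this]
  ring

/-- Given the size of the left subtree, the two subtrees are independent, so the expectation
factors. -/
theorem expect_left_mul_right (n : ℕ) (χ : BinTree → ℝ) :
    expect (n + 1) (fun T => χ T.left * χ T.right) =
      (∑ j ∈ Finset.range (n + 1), expect j χ * expect (n - j) χ) / (n + 1) := by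
  rw [expect_succ]
  simp only [BinaryTree.left, BinaryTree.right, expect_mul_left]
  congr 1
  refine Finset.sum_congr rfl fun j _ => ?_
  rw [mul_comm, ← expect_mul_left]
  simp only [mul_comm]

theorem expect_additive_succ (f : BinTree → ℝ) (n : ℕ) :
    expect (n + 1) (additive f) =
      expect (n + 1) f + 2 / (n + 1) * ∑ j ∈ Finset.range (n + 1), expect j (additive f) := by
  rw [← expect_left_add_right, ← expect_add]
  refine expect_congr fun T hT => ?_
  cases T with
  | nil => simp at hT
  | node u l r => simp only [additive, BinaryTree.left, BinaryTree.right, add_assoc]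

/-- The asymptotic density of fringe trees in `S`. -/
noncomputable def density (S : Set BinTree) : ℝ :=
  ∑' j : ℕ, 2 / (((j : ℝ) + 2) * (j + 3)) * prob (j + 1) S

theorem density_term_nonneg (S : Set BinTree) (j : ℕ) :
    0 ≤ 2 / (((j : ℝ) + 2) * (j + 3)) * prob (j + 1) S :=
  mul_nonneg (by positivity) (prob_nonneg _ _)

/-- The weights telescope, so the tail beyond `n` is at most `2 / (n + 2)`: small enough to stay
bounded after multiplication by the factor `n + 2` of the mean. -/
theorem sum_density_term_le (S : Set BinTree) (n m : ℕ) :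
    ∑ j ∈ Finset.range m, 2 / (((j : ℝ) + 2) * (j + 3)) * prob (j + 1) S ≤
      ∑ j ∈ Finset.range n, 2 / (((j : ℝ) + 2) * (j + 3)) * prob (j + 1) S + 2 / ((n : ℝ) + 2) := by
  rcases le_total m n with h | h
  · refine le_add_of_le_of_nonneg ?_ (by positivity)
    exact Finset.sum_le_sum_of_subset_of_nonneg (Finset.range_mono h)
      fun j _ _ => density_term_nonneg S j
  · suffices h' : ∑ j ∈ Finset.range m, 2 / (((j : ℝ) + 2) * (j + 3)) * prob (j + 1) S ≤
        ∑ j ∈ Finset.range n, 2 / (((j : ℝ) + 2) * (j + 3)) * prob (j + 1) S +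
          (2 / ((n : ℝ) + 2) - 2 / ((m : ℝ) + 2)) by
      have : (0 : ℝ) ≤ 2 / ((m : ℝ) + 2) := by positivity
      linarith
    induction m, h using Nat.le_induction with
    | base => simp
    | succ m _ ih =>
      rw [Finset.sum_range_succ]
      have h1 : 2 / (((m : ℝ) + 2) * (m + 3)) * prob (m + 1) S ≤ 2 / (((m : ℝ) + 2) * (m + 3)) :=
        mul_le_of_le_one_right (by positivity) (prob_le_one _ _)
      have h2 : 2 / (((m : ℝ) + 2) * (m + 3)) = 2 / ((m : ℝ) + 2) - 2 / (((m + 1 : ℕ) : ℝ) + 2) := by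
        push_cast
        field_simp
        ring
      linarith

theorem summable_density (S : Set BinTree) :
    Summable fun j : ℕ => 2 / (((j : ℝ) + 2) * (j + 3)) * prob (j + 1) S :=
  summable_of_sum_range_le (density_term_nonneg S) fun m => sum_density_term_le S 0 m

theorem density_le (S : Set BinTree) (n : ℕ) :
    density S ≤
      ∑ j ∈ Finset.range n, 2 / (((j : ℝ) + 2) * (j + 3)) * prob (j + 1) S + 2 / ((n : ℝ) + 2) :=
  Real.tsum_le_of_sum_range_le (density_term_nonneg S) fun m => sum_density_term_le S n m

theorem le_density (S : Set BinTree) (n : ℕ) :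
    ∑ j ∈ Finset.range n, 2 / (((j : ℝ) + 2) * (j + 3)) * prob (j + 1) S ≤ density S :=
  (summable_density S).sum_le_tsum _ fun j _ => density_term_nonneg S j

theorem density_nonneg (S : Set BinTree) : 0 ≤ density S := by simpa using le_density S 0

theorem density_le_one (S : Set BinTree) : density S ≤ 1 := by simpa using density_le S 0

/-- The number of fringe trees in `S`, centred at its asymptotic mean. -/
noncomputable def centred (S : Set BinTree) (T : BinTree) : ℝ :=
  additive (S.indicator 1) T - density S * (T.numNodes + 1)

theorem additive_indicator_nonneg (S : Set BinTree) (T : BinTree) :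
    0 ≤ additive (S.indicator 1) T := by
  induction T with
  | nil => exact le_rfl
  | node u l r ihl ihr =>
    exact add_nonneg (add_nonneg (Set.indicator_nonneg (fun _ _ => zero_le_one) _) ihl) ihr

theorem additive_indicator_le (S : Set BinTree) (T : BinTree) :
    additive (S.indicator 1) T ≤ T.numNodes := by
  induction T with
  | nil => simp [additive]
  | node u l r ihl ihr =>
    have : S.indicator (1 : BinTree → ℝ) (mk l r) ≤ 1 :=
      Set.indicator_le_self' (fun _ _ => zero_le_one) _
    rw [additive, BinaryTree.numNodes]
    push_cast
    linarith

theorem abs_centred_le (S : Set BinTree) (T : BinTree) : |centred S T| ≤ T.numNodes + 1 := by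
  have h0 := additive_indicator_nonneg S T
  have h1 := additive_indicator_le S T
  have h2 := mul_le_mul_of_nonneg_right (density_le_one S) (by positivity : 0 ≤ (T.numNodes : ℝ) + 1)
  have h3 := mul_nonneg (density_nonneg S) (by positivity : 0 ≤ (T.numNodes : ℝ) + 1)
  rw [centred, abs_le]
  constructor <;> linarith

/-- The `+ 1` in the centring makes `numNodes + 1` additive over the two subtrees, so no extra toll
appears. -/
theorem centred_mk (S : Set BinTree) (l r : BinTree) :
    centred S (mk l r) = S.indicator 1 (mk l r) + centred S l + centred S r := by
  simp only [centred, additive, BinaryTree.numNodes]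
  push_cast
  ring

theorem abs_expect_centred_le (S : Set BinTree) (n : ℕ) : |expect n (centred S)| ≤ 2 := by
  have hd0 := density_nonneg S
  have hd1 := density_le_one S
  cases n with
  | zero =>
    simp only [expect_zero, centred, additive, BinaryTree.numNodes]
    rw [abs_le]
    constructor <;> norm_num <;> linarith
  | succ n =>
    have h : expect (n + 1) (centred S) =
        expect (n + 1) (additive (S.indicator 1)) - density S * (n + 2) := by
      rw [sub_eq_add_neg, ← expect_const (n + 1) (-(density S * (n + 2))), ← expect_add]
      refine expect_congr fun T hT => ?_
      rw [centred, hT]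
      push_cast
      ring
    have hrec := recurrence_solution (x := fun n => expect n (additive (S.indicator 1)))
      (g := fun n => prob (n + 1) S) (expect_additive_succ _) n
    simp only [expect_zero, additive, zero_add] at hrec
    rw [h, hrec]
    have h1 := le_density S n
    have h2 := density_le S n
    have h3 := prob_nonneg (n + 1) S
    have h4 := prob_le_one (n + 1) S
    have hn : (0 : ℝ) < (n : ℝ) + 2 := by positivity
    have h5 := mul_le_mul_of_nonneg_left h1 hn.le
    have h6 := mul_le_mul_of_nonneg_left h2 hn.le
    rw [mul_add, mul_div_cancel₀ _ hn.ne'] at h6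
    rw [abs_le]
    constructor <;> linarith

theorem expect_centred_sq_succ_le (S : Set BinTree) (n : ℕ) :
    expect (n + 1) (fun T => centred S T ^ 2) ≤ (2 * n + 13) +
      2 / (n + 1) * ∑ j ∈ Finset.range (n + 1), expect j (fun T => centred S T ^ 2) := by
  -- The toll is at most 1 and the centred values of the subtrees sum to at most `n + 2` in absolute
  -- value, so terms involving the toll contribute at most `1 + 2 * (n + 2)`.
  have h : expect (n + 1) (fun T => centred S T ^ 2) ≤
      expect (n + 1) (fun T => (2 * n + 5) + 2 * (centred S T.left * centred S T.right) +
        (centred S T.left ^ 2 + centred S T.right ^ 2)) := by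
    refine expect_mono fun T hT => ?_
    cases T with
    | nil => simp at hT
    | node u l r =>
      simp only [BinaryTree.left, BinaryTree.right, BinaryTree.numNodes] at hT ⊢
      have hl := abs_le.1 (abs_centred_le S l)
      have hr := abs_le.1 (abs_centred_le S r)
      have hN : (l.numNodes : ℝ) + r.numNodes = n := by
        exact_mod_cast (by omega : l.numNodes + r.numNodes = n)
      rw [centred_mk]
      by_cases hS : mk l r ∈ S
      · rw [Set.indicator_of_mem hS, Pi.one_apply]
        nlinarith
      · rw [Set.indicator_of_notMem hS]
        nlinarith
  rw [expect_add, expect_add, expect_const, expect_mul_left, expect_left_mul_right,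
    expect_left_add_right n (fun T => centred S T ^ 2)] at h
  have h2 : (∑ j ∈ Finset.range (n + 1), expect j (centred S) * expect (n - j) (centred S)) /
      ((n : ℝ) + 1) ≤ 4 := by
    rw [div_le_iff₀ (by positivity)]
    calc _ ≤ ∑ j ∈ Finset.range (n + 1), (4 : ℝ) := Finset.sum_le_sum fun j _ => by
            refine (le_abs_self _).trans ?_
            rw [abs_mul]
            have := mul_le_mul (abs_expect_centred_le S j) (abs_expect_centred_le S (n - j))
              (abs_nonneg _) zero_le_two
            linarith
      _ = 4 * ((n : ℝ) + 1) := by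
            rw [Finset.sum_const, Finset.card_range, nsmul_eq_mul]
            push_cast
            ring
  linarith

theorem expect_centred_sq_le (S : Set BinTree) {n : ℕ} (hn : n ≠ 0) :
    expect n (fun T => centred S T ^ 2) ≤
      2 * n * (11 + ∑ k ∈ Finset.range n, 10 / ((k : ℝ) + 2)) := by
  obtain ⟨n, rfl⟩ := Nat.exists_eq_succ_of_ne_zero hn
  set x : ℕ → ℝ := fun n => expect n (fun T => centred S T ^ 2) with hx
  -- Taking `g` to be the defect turns the inequality into an exact recurrence, which can be solved;
  -- only an upper bound on `g` is then needed.
  set g : ℕ → ℝ := fun n => x (n + 1) - 2 / (n + 1) * ∑ j ∈ Finset.range (n + 1), x j with hg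
  -- The bound `2 * k + 13` is relaxed to a multiple of `k + 3` to cancel that factor of the weight,
  -- leaving a harmonic sum.
  have hgle : ∀ k, g k ≤ 5 * (k + 3) := fun k => by
    have := expect_centred_sq_succ_le S k
    have hk : (0 : ℝ) ≤ k := k.cast_nonneg
    simp only [hg, hx]
    linarith
  have hx0 : x 0 ≤ 1 := by
    simp only [hx, expect_zero]
    have := abs_centred_le S .nil
    rw [sq_le_one_iff_abs_le_one]
    simpa using this
  have hsum : ∑ k ∈ Finset.range n, 2 / (((k : ℝ) + 2) * (k + 3)) * g k ≤
      ∑ k ∈ Finset.range (n + 1), 10 / ((k : ℝ) + 2) := by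
    refine (Finset.sum_le_sum fun k _ => ?_).trans
      (Finset.sum_le_sum_of_subset_of_nonneg (Finset.range_mono n.le_succ)
        fun k _ _ => by positivity)
    refine (mul_le_mul_of_nonneg_left (hgle k) (by positivity)).trans (le_of_eq ?_)
    field_simp
    norm_num
  have hpos : 0 ≤ ∑ k ∈ Finset.range (n + 1), 10 / ((k : ℝ) + 2) :=
    Finset.sum_nonneg fun k _ => by positivity
  have hsol := recurrence_solution (x := x) (g := g) (fun n => by simp only [hg]; ring) n
  have hn0 : (0 : ℝ) ≤ n := n.cast_nonneg
  have h1 := mul_le_mul_of_nonneg_left (add_le_add hx0 hsum) (by positivity : 0 ≤ (n : ℝ) + 2)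
  have h2 := hgle n
  change x (n + 1) ≤ _
  rw [hsol]
  push_cast
  nlinarith [mul_nonneg hn0 hpos]

/-! ### Convergence in probability -/

theorem TendstoInProb.congr' {φ ψ : ℕ → BinTree → ℝ} {c : ℝ} (h : TendstoInProb φ c)
    (hφψ : ∀ᶠ n in atTop, φ n = ψ n) : TendstoInProb ψ c := fun ε hε =>
  (h ε hε).congr' (hφψ.mono fun n hn => by simp only [hn])

theorem TendstoInProb.comp₂ {φ ψ : ℕ → BinTree → ℝ} {a b : ℝ} (hφ : TendstoInProb φ a)
    (hψ : TendstoInProb ψ b) {g : ℝ × ℝ → ℝ} (hg : ContinuousAt g (a, b)) :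
    TendstoInProb (fun n T => g (φ n T, ψ n T)) (g (a, b)) := by
  intro ε hε
  obtain ⟨δ, hδ, h⟩ := Metric.continuousAt_iff.1 hg ε hε
  have hlim := (hφ δ hδ).add (hψ δ hδ)
  rw [add_zero] at hlim
  refine squeeze_zero (fun n => prob_nonneg _ _) (fun n => prob_le_add fun T hT => ?_) hlim
  by_contra hcon
  simp only [Set.mem_union, Set.mem_ofPred_eq, not_or, not_le] at hcon
  refine absurd (h (x := (φ n T, ψ n T)) ?_) (not_lt.2 hT)
  rw [Prod.dist_eq, max_lt_iff]
  exact hcon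

theorem TendstoInProb.tendsto_expect {φ : ℕ → BinTree → ℝ} {c : ℝ} (h : TendstoInProb φ c)
    (h0 : ∀ n T, 0 ≤ φ n T) (h1 : ∀ n T, φ n T ≤ 1) :
    Tendsto (fun n => expect n (φ n)) atTop (𝓝 c) := by
  classical
  rw [Metric.tendsto_atTop']
  intro ε hε
  have hlim := (h (ε / 2) (half_pos hε)).const_mul (1 + |c|)
  rw [mul_zero] at hlim
  obtain ⟨N, hN⟩ := eventually_atTop.1 (hlim.eventually (gt_mem_nhds (half_pos hε)))
  refine ⟨N, fun n hn => ?_⟩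
  have key : ∀ T, |φ n T - c| ≤
      ε / 2 + (1 + |c|) * {T | ε / 2 ≤ |φ n T - c|}.indicator 1 T := by
    intro T
    by_cases hT : ε / 2 ≤ |φ n T - c|
    · rw [Set.indicator_of_mem (by exact hT), Pi.one_apply, mul_one]
      have := abs_sub (φ n T) c
      rw [abs_of_nonneg (h0 n T)] at this
      linarith [h1 n T]
    · rw [Set.indicator_of_notMem (by exact hT)]
      linarith [not_le.1 hT]
  have e : ∀ d : ℝ, expect n (fun T =>
      d + (ε / 2 + (1 + |c|) * {T | ε / 2 ≤ |φ n T - c|}.indicator 1 T)) =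
      d + (ε / 2 + (1 + |c|) * prob n {T | ε / 2 ≤ |φ n T - c|}) := fun d => by
    rw [expect_add, expect_add, expect_mul_left, expect_const, expect_const, prob]
  have hup : expect n (φ n) ≤ c + (ε / 2 + (1 + |c|) * prob n {T | ε / 2 ≤ |φ n T - c|}) := by
    rw [← e]
    exact expect_mono fun T _ => by linarith [(abs_le.1 (key T)).2]
  have hlo : c ≤
      expect n (φ n) + (ε / 2 + (1 + |c|) * prob n {T | ε / 2 ≤ |φ n T - c|}) := by
    have := expect_mono (n := n) (φ := fun _ => c) (ψ := fun T => φ n T +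
      (ε / 2 + (1 + |c|) * {T | ε / 2 ≤ |φ n T - c|}.indicator 1 T))
      fun T _ => by linarith [(abs_le.1 (key T)).1]
    rwa [expect_const, expect_add, expect_add, expect_mul_left, expect_const] at this
  have := hN n hn.le
  rw [Real.dist_eq, abs_lt]
  constructor <;> linarith

theorem tendstoInProb_additive (S : Set BinTree) :
    TendstoInProb (fun n T => additive (S.indicator 1) T / n) (density S) := by
  classical
  intro ε hε
  have hc : Tendsto (fun k : ℕ => 10 / ((k : ℝ) + 2)) atTop (𝓝 0) :=
    tendsto_const_nhds.div_atTop
      (tendsto_atTop_add_const_right _ _ tendsto_natCast_atTop_atTop)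
  have hinv := tendsto_inv_atTop_nhds_zero_nat (𝕜 := ℝ)
  -- The harmonic sum over `n` is a Cesàro mean of a null sequence, so no logarithm estimate is
  -- required.
  have hlim : Tendsto (fun n : ℕ => (4 * (11 * (n : ℝ)⁻¹ +
      (n : ℝ)⁻¹ * ∑ k ∈ Finset.range n, 10 / ((k : ℝ) + 2)) + 2 * ((n : ℝ)⁻¹ * (n : ℝ)⁻¹)) *
      (ε ^ 2)⁻¹) atTop (𝓝 0) := by
    have := ((((hinv.const_mul 11).add hc.cesaro).const_mul 4).add
      ((hinv.mul hinv).const_mul 2)).mul_const (ε ^ 2)⁻¹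
    simpa using this
  refine squeeze_zero' (.of_forall fun n => prob_nonneg _ _) ?_ hlim
  filter_upwards [eventually_ne_atTop 0] with n hn
  have hn' : (0 : ℝ) < n := by exact_mod_cast Nat.pos_of_ne_zero hn
  -- Chebyshev's inequality. Normalizing by `n` instead of `n + 1` shifts the centred value by the
  -- density, absorbed by `(a + d)² ≤ 2a² + 2` for `0 ≤ d ≤ 1`.
  have hmono : prob n {T | ε ≤ |additive (S.indicator 1) T / n - density S|} ≤
      expect n (fun T => (ε ^ 2 * n ^ 2)⁻¹ * (2 * centred S T ^ 2 + 2)) := by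
    refine expect_mono fun T hT => ?_
    by_cases h : ε ≤ |additive (S.indicator 1) T / n - density S|
    · rw [Set.indicator_of_mem (by exact h), Pi.one_apply, inv_mul_eq_div, one_le_div (by positivity)]
      have h1 : additive (S.indicator 1) T / n - density S = (centred S T + density S) / n := by
        rw [centred, hT]
        field_simp
        ring
      rw [h1, abs_div, abs_of_pos hn', le_div_iff₀ hn'] at h
      have h2 := pow_le_pow_left₀ (by positivity) h 2
      rw [sq_abs, mul_pow] at h2
      have h3 := density_nonneg S
      have h4 := density_le_one S
      nlinarith [sq_nonneg (centred S T - density S)]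
    · rw [Set.indicator_of_notMem (by exact h)]
      positivity
  refine hmono.trans ?_
  rw [expect_mul_left, expect_add, expect_mul_left, expect_const]
  have hD := expect_centred_sq_le S hn
  calc (ε ^ 2 * (n : ℝ) ^ 2)⁻¹ * (2 * expect n (fun T => centred S T ^ 2) + 2)
      ≤ (ε ^ 2 * (n : ℝ) ^ 2)⁻¹ *
        (2 * (2 * n * (11 + ∑ k ∈ Finset.range n, 10 / ((k : ℝ) + 2))) + 2) := by gcongr
    _ = _ := by
      field_simp
      ring

/-! ### Compressed binary search trees -/

theorem tendstoInProb_fringeCount (t : BinTree) :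
    TendstoInProb (fun n T => (fringeCount t T.compress : ℝ) / n) (betaHat t) := by
  simp only [fringeCount_compress, betaHat_eq]
  exact tendstoInProb_additive (subdivisions t)

theorem betaHat_single : betaHat single = 1 / 3 := by
  classical
  rw [betaHat_eq, subdivisions_single, tsum_eq_single 0]
  · have : prob (0 + 1) {single} = 1 := by
      rw [prob, expect_succ]
      simp [expect_zero]
    rw [this]
    norm_num
  · intro j hj
    have : prob (j + 1) {single} = 0 := by
      rw [prob, ← expect_const (j + 1) 0]
      refine expect_congr fun T hT => Set.indicator_of_notMem ?_ _
      rintro rfl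
      simp only [BinaryTree.numNodes] at hT
      omega
    rw [this, mul_zero]

theorem tendstoInProb_quenchedQ (t : BinTree) :
    TendstoInProb (fun _ T => quenchedQ T.compress t) (3 * (leafSize t : ℝ) * betaHat t) := by
  have hg : ContinuousAt (fun z : ℝ × ℝ => (leafSize t : ℝ) * z.1 / z.2)
      (betaHat t, betaHat single) :=
    (continuousAt_const.mul continuousAt_fst).div continuousAt_snd (by
      rw [betaHat_single]
      norm_num)
  have h := (tendstoInProb_fringeCount t).comp₂ (tendstoInProb_fringeCount single) hg
  have hc : 3 * (leafSize t : ℝ) * betaHat t = leafSize t * betaHat t / betaHat single := by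
    rw [betaHat_single]
    ring
  rw [hc]
  refine h.congr' ?_
  -- For `n ≠ 0` the normalizations by `n` cancel in the ratio of the two counts.
  filter_upwards [eventually_ne_atTop 0] with n hn
  funext T
  have hn' : (n : ℝ) ≠ 0 := Nat.cast_ne_zero.2 hn
  simp only [quenchedQ_eq, leafSize_eq_fringeCount T.compress]
  rw [← mul_div_assoc, div_div_div_cancel_right₀ hn']

end BinTree

theorem mainTheorem11
    {Ω : Type*} [MeasurableSpace Ω] (P : Measure Ω) [IsProbabilityMeasure P]
    (T : ℕ → Ω → BinTree) (hT : ∀ n, HasLaw (T n) (BinTree.bst n).toMeasure P)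
    (t : BinTree) (ht : t.IsFull) :
    -- the constant `betaHat t` is the limit in probability of the normalized fringe tree counts
    TendstoInMeasure P
      (fun (n : ℕ) ω => (BinTree.fringeCount t (T n ω).compress : ℝ) / n)
      atTop (fun _ => t.betaHat) ∧
    -- quenched convergence
    TendstoInMeasure P
      (fun (n : ℕ) ω => BinTree.quenchedQ (T n ω).compress t)
      atTop (fun _ => 3 * (t.leafSize : ℝ) * t.betaHat) ∧
    -- annealed convergence
    Tendsto (fun n : ℕ => BinTree.annealedQ (BinTree.compressedBst n) t)
      atTop (𝓝 (3 * (t.leafSize : ℝ) * t.betaHat)) := by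
  refine ⟨(BinTree.tendstoInProb_fringeCount t).tendstoInMeasure hT,
    (BinTree.tendstoInProb_quenchedQ t).tendstoInMeasure hT, ?_⟩
  simp only [BinTree.annealedQ_compressedBst]
  exact (BinTree.tendstoInProb_quenchedQ t).tendsto_expect
    (fun _ T => BinTree.quenchedQ_nonneg T.compress t)
    (fun _ T => BinTree.quenchedQ_le_one T.compress t)
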